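/- For $\alpha\in\mathbb{C}$, let $\mathrm{Li}_\alpha(z)$ denote the polylogarithm on $\mathbb{C}\setminus[1,\infty)$: $\mathrm{Li}_\alpha(z)=\sum_{n=1}^\infty z^n/n^\alpha$ for $|z|<1$, and, for $|z|\ge 1$, $z\notin[1,\infty)$, its analytic continuation, given by the Lindelöf integral $$\mathrm{Li}_\alpha(z)=-\frac{1}{2\pi i}\int_{1/2-i\infty}^{1/2+i\infty}\frac{(-z)^u}{u^\alpha}\,\frac{\pi}{\sin \pi u}\,du$$ (principal branches). Let $\mu>0$ and $x\in(0,2\pi)$. Then the series $\sum_{n\ge1} \frac{2n\cos(nx)}{(n^2+r^2)^{\mu+1}}$ and $\sum_{n\ge1}\frac{2n\sin(nx)}{(n^2+r^2)^{\mu+1}}$ converge absolutely for every $r>0$, and as $r\to\infty$ they have the asymptotic expansions $$\sum_{n=1}^\infty \frac{2n \cos(nx)}{(n^2+r^2)^{\mu+1}} \sim \sum_{k=0}^\infty r^{-2k-2\mu-2}\, \frac{2(-1)^{k}\,\Gamma(k+\mu+1)}{k!\,\Gamma(\mu+1)}\, \mathrm{Re}\big(\mathrm{Li}_{-2k-1}(e^{ix})\big)$$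 and $$\sum_{n=1}^\infty \frac{2n \sin(nx)}{(n^2+r^2)^{\mu+1}} \sim \sum_{k=0}^\infty r^{-2k-2\mu-2}\, \frac{2(-1)^{k}\,\Gamma(k+\mu+1)}{k!\,\Gamma(\mu+1)}\, \mathrm{Im}\big(\mathrm{Li}_{-2k-1}(e^{ix})\big).$$ Here $f(r)\sim\sum_{k=0}^\infty c_k\, r^{-2k-2\mu-2}$ means that for every integer $N\ge0$, $f(r)-\sum_{k=0}^N c_k\, r^{-2k-2\mu-2}=o\big(r^{-2N-2\mu-2}\big)$ as $r\to\infty$. -/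

import Mathlib

/-- The Lindelöf integral
`-(1 / (2πi)) ∫_{1/2 - i∞}^{1/2 + i∞} (-z)^u / u^α · π / sin (π u) du`,
with principal branches, the vertical line being parametrised by `u = 1/2 + i t`, `du = i dt`. -/
noncomputable def lindelofIntegral (α z : ℂ) : ℂ :=
  -(1 / (2 * (Real.pi : ℂ) * Complex.I)) *
    ∫ t : ℝ,
      (-z) ^ ((1 / 2 : ℂ) + (t : ℂ) * Complex.I) / ((1 / 2 : ℂ) + (t : ℂ) * Complex.I) ^ α *
        ((Real.pi : ℂ) / Complex.sin ((Real.pi : ℂ) * ((1 / 2 : ℂ) + (t : ℂ) * Complex.I))) *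
        Complex.I

open Classical in
/-- The polylogarithm `Li_α(z)` for `α ∈ ℂ` and `z ∈ ℂ \ [1, ∞)`: the series `∑_{n ≥ 1} z^n / n^α`
in the open unit disk, and its analytic continuation, given by the Lindelöf integral, outside.
(The Lindelöf integral equals the series for `|z| < 1`, `z ∉ [0, 1)`, but it does not converge
absolutely for `z ∈ (0, 1)` in general.) -/
noncomputable def polylog (α z : ℂ) : ℂ :=
  if ‖z‖ < 1 then ∑' n : ℕ, z ^ (n + 1) / ((n : ℂ) + 1) ^ α else lindelofIntegral α z

/-- The asymptotic expansion (in the sense of Poincaré) `f ∼ ∑_{k ≥ 0} c k • φ k` along the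
filter `l`: the `φ k` form an asymptotic scale, and the error of every partial sum is of smaller
order than the last scale function `φ N` that it contains. -/
def HasAsymptoticExpansion (f : ℝ → ℝ) (φ : ℕ → ℝ → ℝ) (c : ℕ → ℝ) (l : Filter ℝ) : Prop :=
  (∀ k : ℕ, Asymptotics.IsLittleO l (φ (k + 1)) (φ k)) ∧
    ∀ N : ℕ, Asymptotics.IsLittleO l
      (fun r => f r - ∑ k ∈ Finset.range (N + 1), c k * φ k r) (φ N)

/-- The summand with index `n` of the Mathieu cosine series. -/
noncomputable def mathieuCosTerm (μ x r : ℝ) (n : ℕ) : ℝ :=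
  2 * (n : ℝ) * Real.cos ((n : ℝ) * x) / ((n : ℝ) ^ 2 + r ^ 2) ^ (μ + 1)

/-- The summand with index `n` of the Mathieu sine series. -/
noncomputable def mathieuSinTerm (μ x r : ℝ) (n : ℕ) : ℝ :=
  2 * (n : ℝ) * Real.sin ((n : ℝ) * x) / ((n : ℝ) ^ 2 + r ^ 2) ^ (μ + 1)

open Complex MeasureTheory Filter Topology

/-! Write `z = exp (i x) = -exp (i a)` with `a = x - π`, so `|a| < π`, and let `g u = 2 u / (u² +
r²) ^ (μ + 1)`. The kernel `K u = exp (i a u) π / sin (π u)` decays like `exp (-(π - |a|) |Im u|)`,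
so it absorbs any polynomial growth on `Re u = 1/2`. Moving that line to the right collects the
residues of `g K` at the positive integers and gives `∑ z ^ n g n = -(1 / 2π) ∫ g K`
(`tsum_mathieuFun_eq`). Since `K (u + 1) = z K u`, one residue, at `1`, is enough:
`integral_lindelofKernel_step` is iterated on the translates of `g`.

The dependence on `r` now sits in `g` alone. Expanding `(1 + u² / r²) ^ (-(μ + 1))` binomially under
the integral produces the moments of `u ^ (2k + 1)` against `K`, which are the Lindelöf integrals of
`Li_{-2k-1}(z)` (`polylog_neg_odd_eq`). The binomial series does not converge along the whole line;
`exists_norm_mathieuFun_sub_le` bounds the truncation error there by a power of `1 / r` times a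
polynomial in `|t|`. Real and imaginary parts give the two expansions. -/

/-! ### Elementary integrals and estimates -/

theorem one_add_abs_pow_mul_exp_le (M : ℕ) {δ : ℝ} (hδ : 0 < δ) :
    ∃ C : ℝ, 0 ≤ C ∧ ∀ t : ℝ,
      (1 + |t|) ^ M * Real.exp (-(δ * |t|)) ≤ C * (1 + t ^ 2)⁻¹ := by
  refine ⟨(M + 2).factorial * δ⁻¹ ^ (M + 2) * Real.exp δ, by positivity, fun t => ?_⟩
  -- The two powers beyond `M` pay for the factor `1 + t ^ 2`.
  have h1 := Real.pow_div_factorial_le_exp (δ * (1 + |t|)) (by positivity) (M + 2)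
  have h2 : 1 + t ^ 2 ≤ (1 + |t|) ^ 2 := by nlinarith [abs_nonneg t, sq_abs t]
  have hpos : 0 < 1 + t ^ 2 := by positivity
  rw [← div_eq_mul_inv, le_div_iff₀ hpos, Real.exp_neg]
  have h3 : (1 + |t|) ^ (M + 2) ≤
      (M + 2).factorial * δ⁻¹ ^ (M + 2) * (Real.exp δ * Real.exp (δ * |t|)) := by
    rw [← Real.exp_add, show δ + δ * |t| = δ * (1 + |t|) by ring]
    rw [div_le_iff₀ (by positivity), mul_pow] at h1
    calc (1 + |t|) ^ (M + 2) = δ⁻¹ ^ (M + 2) * (δ ^ (M + 2) * (1 + |t|) ^ (M + 2)) := by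
          rw [← mul_assoc, ← mul_pow, inv_mul_cancel₀ hδ.ne', one_pow, one_mul]
      _ ≤ δ⁻¹ ^ (M + 2) * (Real.exp (δ * (1 + |t|)) * (M + 2).factorial) := by gcongr
      _ = _ := by ring
  calc (1 + |t|) ^ M * (Real.exp (δ * |t|))⁻¹ * (1 + t ^ 2)
      ≤ (1 + |t|) ^ M * (Real.exp (δ * |t|))⁻¹ * (1 + |t|) ^ 2 := by gcongr
    _ = (1 + |t|) ^ (M + 2) * (Real.exp (δ * |t|))⁻¹ := by ring
    _ ≤ (M + 2).factorial * δ⁻¹ ^ (M + 2) * (Real.exp δ * Real.exp (δ * |t|)) *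
        (Real.exp (δ * |t|))⁻¹ := by gcongr
    _ = _ := by field_simp

theorem integral_inv_quarter_add_sq : ∫ y : ℝ, (1 / 4 + y ^ 2)⁻¹ = 2 * Real.pi := by
  have h := Measure.integral_comp_mul_left (fun y : ℝ => (1 + y ^ 2)⁻¹) 2
  rw [integral_univ_inv_one_add_sq] at h
  have h2 : ∀ y : ℝ, (1 / 4 + y ^ 2)⁻¹ = 4 * (1 + (2 * y) ^ 2)⁻¹ := fun y => by
    have : 0 < 1 / 4 + y ^ 2 := by positivity
    have : 0 < 1 + (2 * y) ^ 2 := by positivity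
    field_simp
    ring
  simp_rw [h2]
  rw [integral_const_mul, h, abs_of_pos (by norm_num), smul_eq_mul]
  ring

theorem integrable_inv_quarter_add_sq : Integrable fun y : ℝ => (1 / 4 + y ^ 2)⁻¹ := by
  -- A non-integrable function has integral `0` by convention, but this integral is `2π`.
  by_contra h
  have := integral_undef h
  rw [integral_inv_quarter_add_sq] at this
  linarith [Real.pi_pos]

/-! ### Residue theorem in a strip -/

/-- Residue theorem across a vertical strip containing one simple pole, located at `1`. -/
theorem integral_vertical_sub_of_simple_pole {f F : ℂ → ℂ}
    (hf : DifferentiableOn ℂ f {u | 0 < u.re ∧ u.re < 2})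
    (hF : ∀ u : ℂ, 0 < u.re → u.re < 2 → u ≠ 1 → F u = f u / (u - 1))
    {C : ℝ} (hC : ∀ u : ℂ, 1 / 2 ≤ u.re → u.re ≤ 3 / 2 → 1 ≤ |u.im| →
      ‖F u‖ ≤ C * (1 + u.im ^ 2)⁻¹)
    (h1 : Integrable fun t : ℝ => F (1 / 2 + t * I))
    (h3 : Integrable fun t : ℝ => F (3 / 2 + t * I)) :
    (∫ t : ℝ, F (3 / 2 + t * I)) - ∫ t : ℝ, F (1 / 2 + t * I) = 2 * Real.pi * f 1 := by
  set s : Set ℂ := {u | 0 < u.re ∧ u.re < 2} with hs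
  have hso : IsOpen s :=
    (isOpen_lt continuous_const continuous_re).inter (isOpen_lt continuous_re continuous_const)
  have h1s : s ∈ 𝓝 (1 : ℂ) := hso.mem_nhds (by simp [hs])
  -- `dslope f 1` is `F` minus its polar part, so Cauchy's theorem on rectangles applies to it.
  have hG : DifferentiableOn ℂ (dslope f 1) s := (Complex.differentiableOn_dslope h1s).2 hf
  have hGF : ∀ u : ℂ, 0 < u.re → u.re < 2 → u ≠ 1 → dslope f 1 u = F u - f 1 / (u - 1) := by
    intro u h0 h2 hu
    rw [dslope_of_ne _ hu, slope_def_field, hF u h0 h2 hu, sub_div]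
  have hne : ∀ (c t : ℝ), c ≠ 1 → (c : ℂ) + t * I ≠ 1 := by
    intro c t hc h
    have := congrArg Complex.re h
    simp at this
    exact hc this
  -- the horizontal sides
  have hhor : ∀ T : ℝ, 1 ≤ |T| → ‖∫ σ : ℝ in (1 / 2 : ℝ)..(3 / 2 : ℝ), dslope f 1 (σ + T * I)‖ ≤
      C * (1 + T ^ 2)⁻¹ + ‖f 1‖ * |T|⁻¹ := by
    intro T hT
    have hT0 : T ≠ 0 := by rintro rfl; norm_num at hT
    have := intervalIntegral.norm_integral_le_of_norm_le_const
      (a := (1 / 2 : ℝ)) (b := 3 / 2) (f := fun σ : ℝ => dslope f 1 (σ + T * I))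
      (C := C * (1 + T ^ 2)⁻¹ + ‖f 1‖ * |T|⁻¹) ?_
    · norm_num at this ⊢
      exact this
    · intro σ hσ
      rw [Set.uIoc_of_le (by norm_num)] at hσ
      have hne1 : (σ : ℂ) + T * I ≠ 1 := by
        intro h
        have := congrArg Complex.im h
        simp at this
        exact hT0 this
      rw [hGF _ (by simp; linarith [hσ.1]) (by simp; linarith [hσ.2]) hne1]
      refine (norm_sub_le _ _).trans (add_le_add ?_ ?_)
      · simpa using hC (σ + T * I) (by simpa using hσ.1.le) (by simpa using hσ.2) (by simpa using hT)
      · rw [norm_div, div_eq_mul_inv]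
        gcongr
        simpa using Complex.abs_im_le_norm ((σ : ℂ) + T * I - 1)
  have hlim0 : Tendsto (fun T : ℝ => C * (1 + T ^ 2)⁻¹ + ‖f 1‖ * |T|⁻¹) atTop (𝓝 0) := by
    have ha : Tendsto (fun T : ℝ => (1 + T ^ 2)⁻¹) atTop (𝓝 0) :=
      tendsto_inv_atTop_zero.comp
        (tendsto_atTop_add_const_left _ _ (tendsto_pow_atTop two_ne_zero))
    have hb : Tendsto (fun T : ℝ => |T|⁻¹) atTop (𝓝 0) :=
      tendsto_inv_atTop_zero.comp tendsto_abs_atTop_atTop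
    simpa using (ha.const_mul C).add (hb.const_mul ‖f 1‖)
  have hA : Tendsto (fun T : ℝ => ∫ σ : ℝ in (1 / 2 : ℝ)..(3 / 2 : ℝ), dslope f 1 (σ + T * I))
      atTop (𝓝 0) := by
    refine squeeze_zero_norm' ?_ hlim0
    filter_upwards [eventually_ge_atTop 1] with T hT
    exact hhor T (hT.trans (le_abs_self T))
  have hB : Tendsto (fun T : ℝ => ∫ σ : ℝ in (1 / 2 : ℝ)..(3 / 2 : ℝ),
      dslope f 1 (σ + (-T : ℝ) * I)) atTop (𝓝 0) := by
    refine squeeze_zero_norm' ?_ hlim0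
    filter_upwards [eventually_ge_atTop 1] with T hT
    simpa using hhor (-T) (by simpa using hT.trans (le_abs_self T))
  -- the vertical sides
  have hdiff : ∀ y : ℝ, dslope f 1 (3 / 2 + y * I) - dslope f 1 (1 / 2 + y * I) =
      F (3 / 2 + y * I) - F (1 / 2 + y * I) - f 1 * ((1 / 4 + y ^ 2)⁻¹ : ℝ) := by
    intro y
    have e3 : (3 / 2 : ℂ) + y * I ≠ 1 := by simpa using hne (3 / 2) y (by norm_num)
    have e1 : (1 / 2 : ℂ) + y * I ≠ 1 := by simpa using hne (1 / 2) y (by norm_num)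
    rw [hGF _ (by norm_num) (by norm_num) e3, hGF _ (by norm_num) (by norm_num) e1]
    have : ((1 / 4 + y ^ 2 : ℝ) : ℂ) = -((3 / 2 + y * I - 1) * (1 / 2 + y * I - 1)) := by
      push_cast
      linear_combination (y : ℂ) ^ 2 * I_sq
    rw [Complex.ofReal_inv, this]
    have e3' := sub_ne_zero.2 e3
    have e1' := sub_ne_zero.2 e1
    have : ∀ A B p q c : ℂ, p ≠ 0 → q ≠ 0 → p - q = 1 →
        A - c / p - (B - c / q) = A - B - c * (-(p * q))⁻¹ := by
      intro A B p q c hp hq hpq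
      field_simp
      linear_combination c * hpq
    exact this _ _ _ _ _ e3' e1' (by ring)
  have hint : Integrable fun y : ℝ =>
      F (3 / 2 + y * I) - F (1 / 2 + y * I) - f 1 * (((1 / 4 + y ^ 2)⁻¹ : ℝ) : ℂ) :=
    (h3.sub h1).sub (integrable_inv_quarter_add_sq.ofReal.const_mul _)
  have hlim := intervalIntegral_tendsto_integral hint tendsto_neg_atTop_atBot tendsto_id
  have hcont : ∀ c : ℝ, 0 < c → c < 2 → Continuous fun y : ℝ => dslope f 1 (c + y * I) := by
    intro c h0 h2
    refine hG.continuousOn.comp_continuous (by fun_prop) fun y => ?_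
    simp [hs, h0, h2]
  have hzero : Tendsto (fun T : ℝ => ∫ y in (-T)..(id T),
      (F (3 / 2 + y * I) - F (1 / 2 + y * I) - f 1 * (((1 / 4 + y ^ 2)⁻¹ : ℝ) : ℂ)))
      atTop (𝓝 0) := by
    have hAB := (hA.sub hB).mul_const (-I)
    rw [sub_zero, zero_mul] at hAB
    refine hAB.congr fun T => ?_
    have hrect := Complex.integral_boundary_rect_eq_zero_of_differentiableOn (dslope f 1)
      (((1 / 2 : ℝ) : ℂ) + ((-T : ℝ) : ℂ) * I) (((3 / 2 : ℝ) : ℂ) + (T : ℂ) * I) ?_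
    · simp only [Complex.add_re, Complex.ofReal_re, Complex.mul_re, Complex.I_re, mul_zero,
        Complex.ofReal_im, Complex.I_im, mul_one, sub_zero, add_zero, Complex.add_im,
        Complex.mul_im, zero_add, smul_eq_mul] at hrect
      simp_rw [← hdiff]
      have c3 := hcont (3 / 2) (by norm_num) (by norm_num)
      have c1 := hcont (1 / 2) (by norm_num) (by norm_num)
      push_cast at c3 c1 hrect ⊢
      rw [intervalIntegral.integral_sub (c3.intervalIntegrable _ _) (c1.intervalIntegrable _ _)]
      simp only [id]
      linear_combination I * hrect - ((∫ y in (-T)..T, dslope f 1 (3 / 2 + y * I)) -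
        ∫ y in (-T)..T, dslope f 1 (1 / 2 + y * I)) * I_sq
    · refine hG.mono fun u hu => ?_
      rw [Complex.mem_reProdIm] at hu
      have := hu.1
      simp only [Complex.add_re, Complex.ofReal_re, Complex.mul_re, Complex.I_re, mul_zero,
        Complex.ofReal_im, Complex.I_im, mul_one, sub_zero, add_zero] at this
      rw [Set.uIcc_of_le (by norm_num)] at this
      exact ⟨by linarith [this.1], by linarith [this.2]⟩
  have hfin := tendsto_nhds_unique hlim hzero
  rw [integral_sub (f := fun y : ℝ => F (3 / 2 + y * I) - F (1 / 2 + y * I))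
    (g := fun y : ℝ => f 1 * (((1 / 4 + y ^ 2)⁻¹ : ℝ) : ℂ)) (h3.sub h1)
    (integrable_inv_quarter_add_sq.ofReal.const_mul _),
    integral_sub h3 h1, integral_const_mul, integral_complex_ofReal,
    integral_inv_quarter_add_sq] at hfin
  push_cast at hfin
  linear_combination hfin

/-! ### The Lindelöf kernel -/

/-- The kernel `(-z) ^ u * π / sin (π u)` of the Lindelöf integral at `-z = exp (i a)`. -/
noncomputable def lindelofKernel (a : ℝ) (u : ℂ) : ℂ :=
  cexp (a * I * u) * (Real.pi / Complex.sin (Real.pi * u))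

theorem lindelofKernel_add_one (a : ℝ) (u : ℂ) :
    lindelofKernel a (u + 1) = -cexp (a * I) * lindelofKernel a u := by
  simp only [lindelofKernel, mul_add, mul_one, Complex.exp_add, Complex.sin_add_pi, div_neg]
  ring

theorem sinh_abs_im_le_norm_sin (w : ℂ) : Real.sinh |w.im| ≤ ‖Complex.sin w‖ := by
  have h := abs_norm_sub_norm_le (cexp (-w * I)) (cexp (w * I))
  rw [Complex.norm_exp, Complex.norm_exp] at h
  have h2 : ‖Complex.sin w‖ = ‖cexp (-w * I) - cexp (w * I)‖ / 2 := by
    rw [Complex.sin]; simp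
  rw [h2, Real.sinh_eq]
  simp at h
  rcases abs_cases w.im with ⟨h0, _⟩ | ⟨h0, _⟩ <;> rw [h0] <;>
    [have := le_abs_self (Real.exp w.im - Real.exp (-w.im));
     have := neg_le_abs (Real.exp w.im - Real.exp (-w.im))] <;> simp <;> linarith

theorem norm_exp_real_mul_I_mul_le (a : ℝ) (u : ℂ) :
    ‖cexp (a * I * u)‖ ≤ Real.exp (|a| * |u.im|) := by
  rw [Complex.norm_exp]
  simp
  rw [← abs_mul]
  exact neg_le_abs _

theorem norm_lindelofKernel_le_of_norm_sin {a : ℝ} {u : ℂ} {c : ℝ}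
    (h : Real.exp (Real.pi * |u.im|) / c ≤ ‖Complex.sin (Real.pi * u)‖) (hc : 0 < c) :
    ‖lindelofKernel a u‖ ≤ c * Real.pi * Real.exp (-((Real.pi - |a|) * |u.im|)) := by
  rw [lindelofKernel, norm_mul, norm_div, Complex.norm_real, Real.norm_of_nonneg Real.pi_pos.le]
  calc ‖cexp (a * I * u)‖ * (Real.pi / ‖Complex.sin (Real.pi * u)‖)
      ≤ Real.exp (|a| * |u.im|) * (Real.pi / (Real.exp (Real.pi * |u.im|) / c)) := by
        gcongr
        exact norm_exp_real_mul_I_mul_le a u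
    _ = _ := by
        rw [show -((Real.pi - |a|) * |u.im|) = |a| * |u.im| - Real.pi * |u.im| by ring,
          Real.exp_sub]
        field_simp

theorem norm_lindelofKernel_le_of_one_le_abs_im (a : ℝ) {u : ℂ} (hu : 1 ≤ |u.im|) :
    ‖lindelofKernel a u‖ ≤ 4 * Real.pi * Real.exp (-((Real.pi - |a|) * |u.im|)) := by
  refine norm_lindelofKernel_le_of_norm_sin ?_ (by norm_num)
  refine le_trans ?_ (sinh_abs_im_le_norm_sin _)
  have : |((Real.pi : ℂ) * u).im| = Real.pi * |u.im| := by
    simp [abs_mul, abs_of_pos Real.pi_pos]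
  rw [this, Real.sinh_eq]
  set y := Real.pi * |u.im| with hy
  -- Once `exp y ≥ 2`, `sinh y ≥ exp y / 4`, which is the constant `4` of the bound.
  have hy1 : 1 ≤ y := by nlinarith [Real.pi_gt_three]
  have h1 : 2 ≤ Real.exp y := by linarith [Real.add_one_le_exp y]
  have h2 : Real.exp (-y) * Real.exp y = 1 := by rw [← Real.exp_add]; simp
  nlinarith [Real.exp_pos (-y)]

/-- On this line the sine is a positive `cosh`, so the kernel bound needs no distance from the real
axis. -/
theorem sin_pi_mul_half_add (t : ℝ) :
    Complex.sin (Real.pi * (1 / 2 + t * I)) = (Real.cosh (Real.pi * t) : ℝ) := by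
  rw [show (Real.pi : ℂ) * (1 / 2 + t * I) = (Real.pi * t) * I + Real.pi / 2 by ring,
    Complex.sin_add_pi_div_two, Complex.cos_mul_I]
  push_cast
  rfl

theorem norm_lindelofKernel_half_le (a t : ℝ) :
    ‖lindelofKernel a (1 / 2 + t * I)‖ ≤
      4 * Real.pi * Real.exp (-((Real.pi - |a|) * |t|)) := by
  have him : ((1 / 2 : ℂ) + t * I).im = t := by simp
  have := norm_lindelofKernel_le_of_norm_sin (a := a) (u := 1 / 2 + t * I) (c := 4) ?_
    (by norm_num)
  · rwa [him] at this
  · rw [him, sin_pi_mul_half_add, Complex.norm_real, Real.norm_of_nonneg (Real.cosh_pos _).le,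
      ← Real.cosh_abs, abs_mul, abs_of_pos Real.pi_pos, Real.cosh_eq]
    linarith [Real.exp_pos (-(Real.pi * |t|)), Real.exp_pos (Real.pi * |t|)]

theorem continuous_lindelofKernel_half (a : ℝ) :
    Continuous fun t : ℝ => lindelofKernel a (1 / 2 + t * I) := by
  simp only [lindelofKernel, sin_pi_mul_half_add]
  refine Continuous.mul (by fun_prop) (Continuous.div (by fun_prop) ?_ fun t => ?_)
  · exact Complex.continuous_ofReal.comp (Real.continuous_cosh.comp (by fun_prop))
  · exact_mod_cast (Real.cosh_pos _).ne'

/-- Polynomially bounded functions are integrable against the Lindelöf kernel, with a bound. -/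
theorem exists_integral_lindelofKernel_bound {a : ℝ} (ha : |a| < Real.pi) (M : ℕ) :
    ∃ D : ℝ, 0 ≤ D ∧ ∀ (h : ℝ → ℂ) (C : ℝ), Continuous h → 0 ≤ C →
      (∀ t, ‖h t‖ ≤ C * (1 + |t|) ^ M) →
      Integrable (fun t : ℝ => h t * lindelofKernel a (1 / 2 + t * I)) ∧
        ‖∫ t : ℝ, h t * lindelofKernel a (1 / 2 + t * I)‖ ≤ C * D := by
  obtain ⟨B, hB0, hB⟩ := one_add_abs_pow_mul_exp_le M (sub_pos.2 ha)
  refine ⟨4 * Real.pi * B * Real.pi, by positivity, fun h C hh hC0 hC => ?_⟩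
  have hbound : ∀ t : ℝ, ‖h t * lindelofKernel a (1 / 2 + t * I)‖ ≤
      C * (4 * Real.pi * B) * (1 + t ^ 2)⁻¹ := by
    intro t
    rw [norm_mul]
    calc ‖h t‖ * ‖lindelofKernel a (1 / 2 + t * I)‖
        ≤ (C * (1 + |t|) ^ M) * (4 * Real.pi * Real.exp (-((Real.pi - |a|) * |t|))) := by
          gcongr
          · exact hC t
          · exact norm_lindelofKernel_half_le a t
      _ = C * (4 * Real.pi) * ((1 + |t|) ^ M * Real.exp (-((Real.pi - |a|) * |t|))) := by ring
      _ ≤ C * (4 * Real.pi) * (B * (1 + t ^ 2)⁻¹) := by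
          refine mul_le_mul_of_nonneg_left (hB t) (by positivity)
      _ = _ := by ring
  have hi : Integrable fun t : ℝ => C * (4 * Real.pi * B) * (1 + t ^ 2)⁻¹ :=
    integrable_inv_one_add_sq.const_mul _
  refine ⟨hi.mono' (hh.mul (continuous_lindelofKernel_half a)).aestronglyMeasurable
    (Eventually.of_forall hbound), ?_⟩
  refine (norm_integral_le_of_norm_le hi (Eventually.of_forall hbound)).trans_eq ?_
  rw [integral_const_mul, integral_univ_inv_one_add_sq]
  ring

theorem sin_pi_mul_ne_zero_of_re_lt_two {u : ℂ} (h0 : 0 < u.re) (h2 : u.re < 2) (hu : u ≠ 1) :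
    Complex.sin (Real.pi * u) ≠ 0 := by
  rw [Complex.sin_ne_zero_iff]
  intro k hk
  have hpi : (Real.pi : ℂ) ≠ 0 := by exact_mod_cast Real.pi_ne_zero
  have huk : u = k := by
    rw [mul_comm] at hk
    exact mul_right_cancel₀ hpi hk
  rw [huk] at h0 h2
  simp at h0 h2
  have : k = 1 := by
    have : (k : ℝ) < (2 : ℤ) := by exact_mod_cast h2
    have := Int.cast_lt.1 this
    omega
  exact hu (by rw [huk, this]; simp)

/-- The residue at `1` accounts for the first term; antiperiodicity of the sine carries the integral
over `Re u = 3/2` back to `Re u = 1/2`, with `h` translated by `1`. -/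
theorem integral_lindelofKernel_step {a : ℝ} (ha : |a| < Real.pi) {h : ℂ → ℂ} {C : ℝ}
    (hd : DifferentiableOn ℂ h {u | 0 < u.re}) (hC0 : 0 ≤ C)
    (hC : ∀ u : ℂ, 1 / 2 ≤ u.re → u.re ≤ 3 / 2 → ‖h u‖ ≤ C * (1 + |u.im|)) :
    ∫ t : ℝ, h (1 / 2 + t * I) * lindelofKernel a (1 / 2 + t * I) =
      2 * Real.pi * (cexp (a * I) * h 1) -
        cexp (a * I) * ∫ t : ℝ, h (1 / 2 + t * I + 1) * lindelofKernel a (1 / 2 + t * I) := by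
  obtain ⟨D, -, hD⟩ := exists_integral_lindelofKernel_bound ha 1
  have hcont : ∀ c : ℝ, 0 < c → Continuous fun t : ℝ => h (c + t * I) := fun c hc =>
    hd.continuousOn.comp_continuous (by fun_prop) fun t => by simpa using hc
  have e3 : ∀ t : ℝ, (1 / 2 : ℂ) + t * I + 1 = 3 / 2 + t * I := fun t => by ring
  have i1 := (hD (fun t => h (1 / 2 + t * I)) C
    (by simpa using hcont (1 / 2) (by norm_num)) hC0
    (fun t => by simpa using hC (1 / 2 + t * I) (by norm_num) (by norm_num))).1
  have i3 := (hD (fun t => h (3 / 2 + t * I)) C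
    (by simpa using hcont (3 / 2) (by norm_num)) hC0
    (fun t => by simpa using hC (3 / 2 + t * I) (by norm_num) (by norm_num))).1
  have hk3 : ∀ t : ℝ, h (3 / 2 + t * I) * lindelofKernel a (3 / 2 + t * I) =
      -cexp (a * I) * (h (3 / 2 + t * I) * lindelofKernel a (1 / 2 + t * I)) := fun t => by
    rw [← e3, lindelofKernel_add_one]; ring
  -- `S` is the sine with its zero at `1` divided out: it has no zero in the strip, and `S 1 = -π`
  -- fixes the residue.
  set S : ℂ → ℂ := dslope (fun u => Complex.sin (Real.pi * u)) 1 with hS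
  have hso : IsOpen {u : ℂ | 0 < u.re ∧ u.re < 2} :=
    (isOpen_lt continuous_const continuous_re).inter (isOpen_lt continuous_re continuous_const)
  have hsd : Differentiable ℂ fun u : ℂ => Complex.sin (Real.pi * u) := by fun_prop
  have hSd : DifferentiableOn ℂ S {u | 0 < u.re ∧ u.re < 2} :=
    (Complex.differentiableOn_dslope (hso.mem_nhds (by simp))).2 hsd.differentiableOn
  have hS1 : S 1 = -Real.pi := by
    rw [hS, dslope_same]
    have : HasDerivAt (fun u : ℂ => Complex.sin (Real.pi * u))
        (Complex.cos (Real.pi * 1) * (Real.pi * 1)) 1 :=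
      ((hasDerivAt_id (1 : ℂ)).const_mul (Real.pi : ℂ)).csin
    rw [this.deriv]
    simp
  have hSne : ∀ u : ℂ, u ≠ 1 → S u = Complex.sin (Real.pi * u) / (u - 1) := fun u hu => by
    rw [hS, dslope_of_ne _ hu, slope_def_field]
    simp
  have hS0 : ∀ u : ℂ, 0 < u.re → u.re < 2 → S u ≠ 0 := by
    intro u h0 h2
    by_cases hu : u = 1
    · rw [hu, hS1]
      simp
    · rw [hSne u hu]
      exact div_ne_zero (sin_pi_mul_ne_zero_of_re_lt_two h0 h2 hu) (sub_ne_zero.2 hu)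
  obtain ⟨B, hB0, hB⟩ := one_add_abs_pow_mul_exp_le 1 (sub_pos.2 ha)
  have key := integral_vertical_sub_of_simple_pole
    (f := fun u => h u * (cexp (a * I * u) * (Real.pi / S u)))
    (F := fun u => h u * lindelofKernel a u) (C := C * (4 * Real.pi) * B) ?_ ?_ ?_ i1 ?_
  · simp only [hk3, integral_const_mul, hS1, mul_one] at key
    simp only [e3]
    have hpi : (Real.pi : ℂ) ≠ 0 := by exact_mod_cast Real.pi_ne_zero
    rw [div_neg, div_self hpi] at key
    linear_combination -key
  · refine (hd.mono fun u hu => hu.1).mul (DifferentiableOn.mul (by fun_prop) ?_)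
    exact (differentiableOn_const _).div hSd fun u hu => hS0 u hu.1 hu.2
  · intro u h0 h2 hu
    rw [hSne u hu, lindelofKernel]
    have := sub_ne_zero.2 hu
    have := sin_pi_mul_ne_zero_of_re_lt_two h0 h2 hu
    field_simp
  · intro u h1 h3 hu
    rw [norm_mul]
    calc ‖h u‖ * ‖lindelofKernel a u‖
        ≤ (C * (1 + |u.im|)) * (4 * Real.pi * Real.exp (-((Real.pi - |a|) * |u.im|))) := by
          gcongr
          · exact hC u h1 h3
          · exact norm_lindelofKernel_le_of_one_le_abs_im a hu
      _ = C * (4 * Real.pi) * ((1 + |u.im|) ^ 1 * Real.exp (-((Real.pi - |a|) * |u.im|))) := by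
          ring
      _ ≤ C * (4 * Real.pi) * (B * (1 + u.im ^ 2)⁻¹) := by
          refine mul_le_mul_of_nonneg_left (hB u.im) (by positivity)
      _ = _ := by ring
  · simp only [hk3]
    exact i3.const_mul _

/-! ### The Mathieu function in the right half-plane -/

/-- The analytic function whose values at the natural numbers are the Mathieu coefficients. -/
noncomputable def mathieuFun (s r : ℝ) (u : ℂ) : ℂ :=
  2 * u / (u ^ 2 + (r : ℂ) ^ 2) ^ (s : ℂ)

/-- Both factors of `(u - r i) (u + r i)` have real part `Re u`. The bound is uniform in `r`. -/
theorem sq_re_le_norm_sq_add_sq {u : ℂ} (hu : 0 ≤ u.re) (r : ℝ) :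
    u.re ^ 2 ≤ ‖u ^ 2 + (r : ℂ) ^ 2‖ := by
  have h : u ^ 2 + (r : ℂ) ^ 2 = (u - r * I) * (u + r * I) := by
    linear_combination (r : ℂ) ^ 2 * I_sq
  have h1 : u.re ≤ ‖u - r * I‖ := by simpa using Complex.re_le_norm (u - r * I)
  have h2 : u.re ≤ ‖u + r * I‖ := by simpa using Complex.re_le_norm (u + r * I)
  rw [h, norm_mul, sq]
  exact mul_le_mul h1 h2 hu (norm_nonneg _)

theorem sq_add_sq_mem_slitPlane {u : ℂ} (hu : 0 < u.re) (r : ℝ) :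
    u ^ 2 + (r : ℂ) ^ 2 ∈ Complex.slitPlane := by
  rw [Complex.mem_slitPlane_iff]
  by_cases h : u.im = 0
  · left
    have : (u ^ 2 + (r : ℂ) ^ 2).re = u.re ^ 2 + r ^ 2 := by simp [sq, h]
    rw [this]
    positivity
  · right
    have : (u ^ 2 + (r : ℂ) ^ 2).im = 2 * (u.re * u.im) := by
      simp [sq]; ring
    rw [this]
    exact mul_ne_zero two_ne_zero (mul_ne_zero hu.ne' h)

theorem differentiableOn_mathieuFun (s r : ℝ) :
    DifferentiableOn ℂ (mathieuFun s r) {u | 0 < u.re} := by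
  intro u hu
  have hsl := sq_add_sq_mem_slitPlane hu r
  refine DifferentiableAt.differentiableWithinAt ?_
  refine DifferentiableAt.div (by fun_prop) (DifferentiableAt.cpow_const (by fun_prop) hsl) ?_
  rw [Complex.cpow_def_of_ne_zero (Complex.slitPlane_ne_zero hsl)]
  exact Complex.exp_ne_zero _

theorem norm_mathieuFun_le {s : ℝ} (hs : 0 ≤ s) (r : ℝ) {u : ℂ} (hu : 0 < u.re) :
    ‖mathieuFun s r u‖ ≤ 2 * ‖u‖ / (u.re ^ 2) ^ s := by
  rw [mathieuFun, norm_div, norm_mul, Complex.norm_cpow_real, Complex.norm_ofNat]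
  gcongr
  exact sq_re_le_norm_sq_add_sq hu.le r

theorem norm_mathieuFun_le_of_le_re {s : ℝ} (hs : 0 ≤ s) (r : ℝ) {u : ℂ} {c : ℝ} (hc : 0 < c)
    (hu : c ≤ u.re) : ‖mathieuFun s r u‖ ≤ 2 * ‖u‖ / (c ^ 2) ^ s := by
  refine (norm_mathieuFun_le hs r (hc.trans_le hu)).trans ?_
  gcongr

theorem mathieuFun_ofReal {s r y : ℝ} :
    mathieuFun s r (y : ℂ) = ((2 * y / (y ^ 2 + r ^ 2) ^ s : ℝ) : ℂ) := by
  rw [mathieuFun]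
  push_cast
  rw [Complex.ofReal_cpow (by positivity)]
  push_cast
  rfl

theorem summable_mathieuFun {s : ℝ} (hs : 1 < s) (r : ℝ) {z : ℂ} (hz : ‖z‖ = 1) :
    Summable fun n : ℕ => z ^ (n + 1) * mathieuFun s r ((n : ℂ) + 1) := by
  have h1 : Summable fun n : ℕ => 2 * (((n + 1 : ℕ) : ℝ) ^ (1 - 2 * s)) :=
    (((Real.summable_nat_rpow.2 (by linarith)).comp_injective
      (add_left_injective 1))).mul_left 2
  refine Summable.of_norm_bounded h1 fun n => ?_
  rw [norm_mul, norm_pow, hz, one_pow, one_mul]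
  have hn : (0 : ℝ) < (n : ℝ) + 1 := by positivity
  refine (norm_mathieuFun_le (by linarith) r (by simpa using hn)).trans_eq ?_
  have : ‖(n : ℂ) + 1‖ = (n : ℝ) + 1 := by
    exact_mod_cast Complex.norm_natCast (n + 1)
  rw [this]
  simp only [Complex.add_re, Complex.natCast_re, Complex.one_re]
  push_cast
  rw [← Real.rpow_natCast _ 2, ← Real.rpow_mul hn.le, Real.rpow_sub hn, Real.rpow_one]
  push_cast
  ring

/-! ### Summation formula -/

/-- The Lindelöf integral of `h` along the line `Re u = 1/2`, at the point `-exp (i a)`. -/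
noncomputable def lindelofTransform (a : ℝ) (h : ℂ → ℂ) : ℂ :=
  ∫ t : ℝ, h (1 / 2 + t * I) * lindelofKernel a (1 / 2 + t * I)

theorem lindelofTransform_mathieuFun_shift {a : ℝ} (ha : |a| < Real.pi) {s : ℝ} (hs : 0 ≤ s)
    (r : ℝ) (n : ℕ) :
    lindelofTransform a (fun u => mathieuFun s r (u + n)) =
      2 * Real.pi * (cexp (a * I) * mathieuFun s r ((n : ℂ) + 1)) -
        cexp (a * I) * lindelofTransform a (fun u => mathieuFun s r (u + (n + 1 : ℕ))) := by
  have := integral_lindelofKernel_step ha (h := fun u => mathieuFun s r (u + n))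
    (C := 2 * (n + 2) / ((1 / 2) ^ 2) ^ s) ?_ (by positivity) ?_
  · rw [lindelofTransform, this, lindelofTransform, add_comm (1 : ℂ) n]
    congr! 6
    push_cast
    ring
  · refine (differentiableOn_mathieuFun s r).comp (by fun_prop) fun u hu => ?_
    have hu : 0 < u.re := hu
    have : (0 : ℝ) ≤ n := by positivity
    simp
    linarith
  · intro u h1 h3
    have hn : (0 : ℝ) ≤ n := by positivity
    refine (norm_mathieuFun_le_of_le_re hs r (c := 1 / 2) (by norm_num) ?_).trans ?_
    · simp; linarith
    · have : ‖u + n‖ ≤ (n + 2) * (1 + |u.im|) := by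
        refine (Complex.norm_le_abs_re_add_abs_im _).trans ?_
        simp only [Complex.add_re, Complex.natCast_re, Complex.add_im, Complex.natCast_im, add_zero]
        rw [abs_of_nonneg (by linarith)]
        nlinarith [abs_nonneg u.im, mul_nonneg hn (abs_nonneg u.im)]
      calc 2 * ‖u + n‖ / ((1 / 2) ^ 2) ^ s ≤ 2 * ((n + 2) * (1 + |u.im|)) / ((1 / 2) ^ 2) ^ s := by
            gcongr
        _ = _ := by ring

theorem lindelofTransform_mathieuFun_eq_sum {a : ℝ} (ha : |a| < Real.pi) {s : ℝ} (hs : 0 ≤ s)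
    (r : ℝ) (n : ℕ) :
    lindelofTransform a (mathieuFun s r) =
      -(2 * Real.pi) * ∑ k ∈ Finset.range n,
          (-cexp (a * I)) ^ (k + 1) * mathieuFun s r ((k : ℂ) + 1) +
        (-cexp (a * I)) ^ n * lindelofTransform a (fun u => mathieuFun s r (u + n)) := by
  induction n with
  | zero => simp
  | succ n ih =>
    rw [ih, Finset.sum_range_succ, lindelofTransform_mathieuFun_shift ha hs r n]
    ring

/-- On `Re u = n + 1/2` the function is at most a constant times `(n + 1/2) ^ (1 - 2 s) (1 + |t|)`.
-/
theorem tendsto_lindelofTransform_mathieuFun_shift {a : ℝ} (ha : |a| < Real.pi) {s : ℝ}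
    (hs : 1 < s) (r : ℝ) :
    Tendsto (fun n : ℕ => lindelofTransform a (fun u => mathieuFun s r (u + n)))
      atTop (𝓝 0) := by
  obtain ⟨D, hD0, hD⟩ := exists_integral_lindelofKernel_bound ha 1
  have hlim : Tendsto (fun n : ℕ => 4 * ((n : ℝ) + 1 / 2) ^ (-(2 * s - 1)) * D) atTop (𝓝 0) := by
    have h := (tendsto_rpow_neg_atTop (y := 2 * s - 1) (by linarith)).comp
      (tendsto_atTop_add_const_right _ (1 / 2 : ℝ) (tendsto_natCast_atTop_atTop (R := ℝ)))
    simpa using (h.const_mul 4).mul_const D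
  refine squeeze_zero_norm (fun n => ?_) hlim
  refine (hD (fun t => mathieuFun s r (1 / 2 + t * I + n)) _ ?_ (by positivity) fun t => ?_).2
  · refine (differentiableOn_mathieuFun s r).continuousOn.comp_continuous (by fun_prop) fun t => ?_
    simp
    positivity
  · have hc : (0 : ℝ) < n + 1 / 2 := by positivity
    have hn : (0 : ℝ) ≤ n := by positivity
    refine (norm_mathieuFun_le_of_le_re (by linarith) r hc ?_).trans ?_
    · simp; linarith
    · have h1 : ‖(1 / 2 : ℂ) + t * I + n‖ ≤ 2 * ((n + 1 / 2) * (1 + |t|)) := by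
        refine (Complex.norm_le_abs_re_add_abs_im _).trans ?_
        have : |((1 / 2 : ℂ) + t * I + n).re| = n + 1 / 2 := by
          rw [abs_of_nonneg] <;> simp <;> linarith
        rw [this]
        simp
        nlinarith [abs_nonneg t, mul_nonneg hn (abs_nonneg t)]
      have h2 : (((n : ℝ) + 1 / 2) ^ 2) ^ s = ((n : ℝ) + 1 / 2) ^ (2 * s - 1) * (n + 1 / 2) := by
        rw [← Real.rpow_natCast _ 2, ← Real.rpow_mul hc.le, Real.rpow_sub hc, Real.rpow_one]
        push_cast
        field_simp
      rw [h2, Real.rpow_neg hc.le, div_le_iff₀ (by positivity)]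
      have : 0 < ((n : ℝ) + 1 / 2) ^ (2 * s - 1) := by positivity
      have h3 : 4 * (((n : ℝ) + 1 / 2) ^ (2 * s - 1))⁻¹ * (1 + |t|) ^ 1 *
          (((n : ℝ) + 1 / 2) ^ (2 * s - 1) * (n + 1 / 2)) = 4 * ((n + 1 / 2) * (1 + |t|)) := by
        field_simp
      rw [h3]
      linarith

/-- Summation formula of Lindelöf type for the Mathieu coefficients. -/
theorem tsum_mathieuFun_eq {a : ℝ} (ha : |a| < Real.pi) {s : ℝ} (hs : 1 < s) (r : ℝ) {z : ℂ}
    (hz : z = -cexp (a * I)) :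
    ∑' n : ℕ, z ^ (n + 1) * mathieuFun s r ((n : ℂ) + 1) =
      -(1 / (2 * Real.pi)) * lindelofTransform a (mathieuFun s r) := by
  have hz1 : ‖z‖ = 1 := by rw [hz, norm_neg, Complex.norm_exp_ofReal_mul_I]
  have h1 := (summable_mathieuFun hs r hz1).hasSum.tendsto_sum_nat
  have h2 : Tendsto (fun n : ℕ => z ^ n * lindelofTransform a (fun u => mathieuFun s r (u + n)))
      atTop (𝓝 0) := by
    have := (tendsto_lindelofTransform_mathieuFun_shift ha hs r).norm
    rw [norm_zero] at this
    refine squeeze_zero_norm (fun n => ?_) this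
    rw [norm_mul, norm_pow, hz1, one_pow, one_mul]
  have h3 := (h1.const_mul (-(2 * (Real.pi : ℂ)))).add h2
  have h4 : ∀ n : ℕ, -(2 * (Real.pi : ℂ)) * (∑ k ∈ Finset.range n,
      z ^ (k + 1) * mathieuFun s r ((k : ℂ) + 1)) +
      z ^ n * lindelofTransform a (fun u => mathieuFun s r (u + n)) =
      lindelofTransform a (mathieuFun s r) := fun n => by
    rw [hz]
    exact (lindelofTransform_mathieuFun_eq_sum ha (by linarith) r n).symm
  simp only [h4] at h3
  have h5 := tendsto_nhds_unique tendsto_const_nhds h3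
  rw [h5]
  have hpi : (Real.pi : ℂ) ≠ 0 := by exact_mod_cast Real.pi_ne_zero
  field_simp
  ring

/-! ### Binomial expansion under the integral -/

theorem isLittleO_rpow_atTop_of_lt {p q : ℝ} (h : p < q) :
    (fun r : ℝ => r ^ p) =o[atTop] fun r : ℝ => r ^ q := by
  refine Asymptotics.isLittleO_of_tendsto' ?_ ?_
  · filter_upwards [eventually_gt_atTop 0] with r hr h0
    exact absurd h0 (Real.rpow_pos_of_pos hr q).ne'
  · refine (tendsto_rpow_neg_atTop (sub_pos.2 h)).congr' ?_
    filter_upwards [eventually_gt_atTop 0] with r hr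
    rw [← Real.rpow_sub hr]
    ring_nf

theorem choose_neg_eq_Gamma {s : ℝ} (hs : 0 < s) (k : ℕ) :
    Ring.choose (-(s : ℂ)) k =
      (((-1) ^ k * Real.Gamma (k + s) / (k.factorial * Real.Gamma s) : ℝ) : ℂ) := by
  have h1 := Ring.factorial_nsmul_multichoose_eq_ascPochhammer (s : ℂ) k
  rw [Polynomial.ascPochhammer_smeval_eq_eval, ← Complex.Gamma_add_nat_div_Gamma_eq] at h1
  · rw [Ring.choose_neg']
    have hf : (k.factorial : ℂ) ≠ 0 := by exact_mod_cast k.factorial_ne_zero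
    have hG : Complex.Gamma s ≠ 0 := Complex.Gamma_ne_zero_of_re_pos (by simpa using hs)
    rw [nsmul_eq_mul] at h1
    push_cast
    rw [← Complex.Gamma_ofReal, ← Complex.Gamma_ofReal]
    push_cast
    rw [add_comm (k : ℂ)]
    rw [eq_div_iff hG] at h1
    rw [eq_div_iff (mul_ne_zero hf hG), ← h1]
    simp [Int.negOnePow, Units.smul_def]
    ring
  · intro j hj
    have := congrArg Complex.re hj
    simp at this
    have : (0 : ℝ) ≤ j := by positivity
    linarith

/-- A Taylor bound for all `w`. The singularity at `w = -1` stays in the bound as the power itself;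
the free factor `‖w‖ ^ m` is harmless there and later cancels the growth in `r`. -/
theorem exists_norm_one_add_cpow_sub_le (s : ℝ) (m N : ℕ) :
    ∃ C : ℝ, 0 ≤ C ∧ ∀ w : ℂ,
      ‖(1 + w) ^ (-(s : ℂ)) - ∑ k ∈ Finset.range N, Ring.choose (-(s : ℂ)) k * w ^ k‖ ≤
        C * (1 + ‖w‖ ^ m * ‖(1 + w) ^ (-(s : ℂ))‖) * ‖w‖ ^ N := by
  have hO := (Complex.one_add_cpow_hasFPowerSeriesAt_zero
    (a := -(s : ℂ))).isBigO_sub_partialSum_pow N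
  obtain ⟨c, hc0, hc⟩ := hO.exists_pos
  rw [Asymptotics.isBigOWith_iff, Metric.eventually_nhds_iff] at hc
  obtain ⟨δ, hδ, hc⟩ := hc
  set B : ℝ := ∑ k ∈ Finset.range N, ‖Ring.choose (-(s : ℂ)) k‖ * δ⁻¹ ^ (N - k) with hB
  have hB0 : 0 ≤ B := by positivity
  -- `c` is the Taylor constant on `‖w‖ < δ`. Elsewhere `1 ≤ δ⁻¹ ‖w‖` lifts each term to the
  -- required power: `B` serves the polynomial, the last summand the power function.
  refine ⟨c + B + δ⁻¹ ^ (m + N), by positivity, fun w => ?_⟩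
  have hP : (binomialSeries ℂ (-(s : ℂ))).partialSum N w =
      ∑ k ∈ Finset.range N, Ring.choose (-(s : ℂ)) k * w ^ k := by
    simp [FormalMultilinearSeries.partialSum, binomialSeries,
      FormalMultilinearSeries.coeff_ofScalars, mul_comm]
  set A := ‖(1 + w) ^ (-(s : ℂ))‖ with hA
  have hA0 : 0 ≤ A := norm_nonneg _
  rcases lt_or_ge ‖w‖ δ with hw | hw
  · have h := hc (y := w) (by simpa using hw)
    rw [hP, zero_add] at h
    refine h.trans ?_
    rw [norm_pow, norm_norm]
    refine mul_le_mul_of_nonneg_right ?_ (by positivity)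
    have h2 : 0 ≤ δ⁻¹ ^ (m + N) := by positivity
    have h3 : 0 ≤ ‖w‖ ^ m * A := by positivity
    nlinarith [mul_nonneg (add_nonneg (add_nonneg hc0.le hB0) h2) h3]
  · have hw1 : 1 ≤ δ⁻¹ * ‖w‖ := by
      rw [inv_mul_eq_div, one_le_div hδ]; exact hw
    have h1 : A ≤ δ⁻¹ ^ (m + N) * (‖w‖ ^ m * A) * ‖w‖ ^ N := by
      calc A = 1 * A := (one_mul A).symm
        _ ≤ (δ⁻¹ * ‖w‖) ^ (m + N) * A := by
          gcongr
          exact one_le_pow₀ hw1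
        _ = _ := by rw [mul_pow, pow_add ‖w‖]; ring
    have h2 : ‖∑ k ∈ Finset.range N, Ring.choose (-(s : ℂ)) k * w ^ k‖ ≤ B * ‖w‖ ^ N := by
      rw [hB, Finset.sum_mul]
      refine (norm_sum_le _ _).trans (Finset.sum_le_sum fun k hk => ?_)
      rw [norm_mul, norm_pow, mul_assoc]
      refine mul_le_mul_of_nonneg_left ?_ (norm_nonneg _)
      have hk : k ≤ N := (Finset.mem_range.1 hk).le
      calc ‖w‖ ^ k = 1 * ‖w‖ ^ k := (one_mul _).symm
        _ ≤ (δ⁻¹ * ‖w‖) ^ (N - k) * ‖w‖ ^ k := by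
          gcongr
          exact one_le_pow₀ hw1
        _ = δ⁻¹ ^ (N - k) * ‖w‖ ^ N := by
          rw [mul_pow, mul_assoc, ← pow_add, Nat.sub_add_cancel hk]
    refine (norm_sub_le _ _).trans ((add_le_add h1 h2).trans ?_)
    rw [← add_mul]
    refine mul_le_mul_of_nonneg_right ?_ (by positivity)
    have h3 : 0 ≤ ‖w‖ ^ m * A := by positivity
    have h4 : 0 ≤ δ⁻¹ ^ (m + N) := by positivity
    nlinarith [mul_nonneg (add_nonneg hc0.le hB0) h3]

/-- The factor `r²` is positive, so the principal logarithm splits without a branch correction. -/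
theorem mathieuFun_eq_one_add_cpow (s : ℝ) {r : ℝ} (hr : 0 < r) {u : ℂ} (hu : 0 < u.re) :
    mathieuFun s r u = 2 * u * ((r ^ (-2 * s) : ℝ) : ℂ) * (1 + u ^ 2 / r ^ 2) ^ (-(s : ℂ)) := by
  have hrc : (r : ℂ) ≠ 0 := by exact_mod_cast hr.ne'
  have hne := Complex.slitPlane_ne_zero (sq_add_sq_mem_slitPlane hu r)
  have h1 : u ^ 2 + (r : ℂ) ^ 2 = ((r ^ 2 : ℝ) : ℂ) * (1 + u ^ 2 / r ^ 2) := by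
    push_cast
    field_simp
    ring
  have hw : 1 + u ^ 2 / (r : ℂ) ^ 2 ≠ 0 := by
    rintro h
    rw [h1, h, mul_zero] at hne
    exact hne rfl
  have hr2 : ((r ^ 2 : ℝ) : ℂ) ≠ 0 := by exact_mod_cast (pow_pos hr 2).ne'
  have h2 : (((r ^ 2 : ℝ) : ℂ) * (1 + u ^ 2 / r ^ 2)) ^ (s : ℂ) =
      (((r ^ 2) ^ s : ℝ) : ℂ) * (1 + u ^ 2 / r ^ 2) ^ (s : ℂ) := by
    rw [Complex.ofReal_cpow (by positivity), Complex.cpow_def_of_ne_zero (mul_ne_zero hr2 hw),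
      Complex.cpow_def_of_ne_zero hr2, Complex.cpow_def_of_ne_zero hw,
      Complex.log_ofReal_mul (by positivity) hw, ← Complex.exp_add,
      Complex.ofReal_log (by positivity)]
    ring_nf
  have h3 : r ^ (-2 * s) = ((r ^ 2) ^ s)⁻¹ := by
    rw [← Real.rpow_natCast r 2, ← Real.rpow_mul hr.le, ← Real.rpow_neg hr.le]
    push_cast
    ring_nf
  rw [mathieuFun, h1, h2, Complex.cpow_neg, h3, div_eq_mul_inv, mul_inv, Complex.ofReal_inv]
  ring

theorem norm_half_add_mul_I_le (t : ℝ) : ‖(1 / 2 : ℂ) + t * I‖ ≤ 1 + |t| := by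
  refine (norm_add_le _ _).trans ?_
  simp
  norm_num

theorem exists_norm_mathieuFun_sub_le {s : ℝ} (hs : 0 ≤ s) (N : ℕ) :
    ∃ (C : ℝ) (M : ℕ), 0 ≤ C ∧ ∀ r : ℝ, 1 ≤ r → ∀ t : ℝ,
      ‖mathieuFun s r (1 / 2 + t * I) - ∑ k ∈ Finset.range N, Ring.choose (-(s : ℂ)) k *
        (2 * ((r ^ (-2 * s - 2 * k) : ℝ) : ℂ)) * (1 / 2 + t * I) ^ (2 * k + 1)‖ ≤
        C * r ^ (-2 * s - 2 * N) * (1 + |t|) ^ M := by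
  obtain ⟨m, hm⟩ := exists_nat_ge s
  obtain ⟨C, hC0, hC⟩ := exists_norm_one_add_cpow_sub_le s m N
  -- The exponent adds `1` from `2 u`, `2 m` from `hwA` and `2 N` from `‖w‖ ^ N`.
  refine ⟨2 * C * (1 + 4 ^ m), 1 + 2 * m + 2 * N, by positivity, fun r hr t => ?_⟩
  have hr0 : 0 < r := by linarith
  have hrc : (r : ℂ) ≠ 0 := by exact_mod_cast hr0.ne'
  set u : ℂ := 1 / 2 + t * I with hu
  have hure : u.re = 1 / 2 := by simp [hu]
  have hun : ‖u‖ ≤ 1 + |t| := norm_half_add_mul_I_le t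
  set w : ℂ := u ^ 2 / (r : ℂ) ^ 2 with hw
  set T : ℝ := 1 + |t| with hT
  have hT1 : 1 ≤ T := by simp [hT]
  have hpow : ∀ k : ℕ, r ^ (-2 * s - 2 * k) = r ^ (-2 * s) / (r ^ 2) ^ k := fun k => by
    rw [Real.rpow_sub hr0, ← pow_mul, ← Real.rpow_natCast r (2 * k)]
    push_cast
    rfl
  have hdec : mathieuFun s r u - ∑ k ∈ Finset.range N, Ring.choose (-(s : ℂ)) k *
        (2 * ((r ^ (-2 * s - 2 * k) : ℝ) : ℂ)) * u ^ (2 * k + 1) =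
      2 * u * ((r ^ (-2 * s) : ℝ) : ℂ) * ((1 + w) ^ (-(s : ℂ)) -
        ∑ k ∈ Finset.range N, Ring.choose (-(s : ℂ)) k * w ^ k) := by
    rw [mathieuFun_eq_one_add_cpow s hr0 (by rw [hure]; norm_num), mul_sub, Finset.mul_sum]
    congr 1
    refine Finset.sum_congr rfl fun k _ => ?_
    rw [hpow, hw]
    push_cast
    rw [div_pow]
    field_simp
    ring_nf
  have hwn : ‖w‖ ≤ T ^ 2 / r ^ 2 := by
    rw [hw, norm_div, norm_pow, norm_pow, Complex.norm_real, Real.norm_of_nonneg hr0.le]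
    gcongr
  have h1w : (4 * r ^ 2)⁻¹ ≤ ‖1 + w‖ := by
    have h := sq_re_le_norm_sq_add_sq (u := u) (by rw [hure]; norm_num) r
    have h2 : 1 + w = (u ^ 2 + (r : ℂ) ^ 2) / (r : ℂ) ^ 2 := by
      rw [hw]; field_simp; ring
    rw [h2, norm_div, norm_pow, Complex.norm_real, Real.norm_of_nonneg hr0.le,
      le_div_iff₀ (by positivity)]
    rw [hure] at h
    refine le_trans (le_of_eq ?_) h
    field_simp
    norm_num
  have hA : ‖(1 + w) ^ (-(s : ℂ))‖ ≤ (4 * r ^ 2) ^ m := by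
    rw [← Complex.ofReal_neg, Complex.norm_cpow_real]
    calc ‖1 + w‖ ^ (-s) ≤ ((4 * r ^ 2)⁻¹) ^ (-s) :=
          Real.rpow_le_rpow_of_nonpos (by positivity) h1w (by linarith)
      _ = (4 * r ^ 2) ^ s := by rw [Real.inv_rpow (by positivity), ← Real.rpow_neg (by positivity),
          neg_neg]
      _ ≤ (4 * r ^ 2) ^ (m : ℝ) := Real.rpow_le_rpow_of_exponent_le (by nlinarith) hm
      _ = _ := Real.rpow_natCast _ _
  -- Near `u = ± r i` the power can grow like `r ^ (2 s)`. Since `s ≤ m`, the denominator `r ^ (2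
  -- m)` of the bound on `‖w‖ ^ m` cancels this.
  have hwA : ‖w‖ ^ m * ‖(1 + w) ^ (-(s : ℂ))‖ ≤ 4 ^ m * T ^ (2 * m) := by
    calc ‖w‖ ^ m * ‖(1 + w) ^ (-(s : ℂ))‖ ≤ (T ^ 2 / r ^ 2) ^ m * (4 * r ^ 2) ^ m := by gcongr
      _ = 4 ^ m * T ^ (2 * m) := by
        rw [← mul_pow, pow_mul, ← mul_pow]
        congr 1
        field_simp
  have hone : 1 + 4 ^ m * T ^ (2 * m) ≤ (1 + 4 ^ m) * T ^ (2 * m) := by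
    have : 1 ≤ T ^ (2 * m) := one_le_pow₀ hT1
    linarith
  rw [hdec, norm_mul, norm_mul, norm_mul, Complex.norm_ofNat, Complex.norm_real,
    Real.norm_of_nonneg (by positivity)]
  calc 2 * ‖u‖ * r ^ (-2 * s) * ‖(1 + w) ^ (-(s : ℂ)) -
        ∑ k ∈ Finset.range N, Ring.choose (-(s : ℂ)) k * w ^ k‖
      ≤ 2 * T * r ^ (-2 * s) * (C * ((1 + 4 ^ m) * T ^ (2 * m)) * (T ^ 2 / r ^ 2) ^ N) := by
        gcongr
        refine (hC w).trans ?_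
        gcongr
        exact (add_le_add_right hwA 1).trans hone
    _ = _ := by
        rw [hpow, div_pow]
        ring_nf

theorem exists_norm_lindelofTransform_mathieuFun_sub_le {a : ℝ} (ha : |a| < Real.pi) {s : ℝ}
    (hs : 0 ≤ s) (N : ℕ) :
    ∃ C : ℝ, ∀ r : ℝ, 1 ≤ r →
      ‖lindelofTransform a (mathieuFun s r) - ∑ k ∈ Finset.range N, Ring.choose (-(s : ℂ)) k *
        (2 * ((r ^ (-2 * s - 2 * k) : ℝ) : ℂ)) *
          lindelofTransform a (fun u => u ^ (2 * k + 1))‖ ≤ C * r ^ (-2 * s - 2 * N) := by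
  obtain ⟨C, M, hC0, hC⟩ := exists_norm_mathieuFun_sub_le hs N
  obtain ⟨D, hD0, hD⟩ := exists_integral_lindelofKernel_bound ha M
  refine ⟨C * D, fun r hr => ?_⟩
  have hmono : ∀ k : ℕ, Integrable fun t : ℝ =>
      ((1 / 2 : ℂ) + t * I) ^ (2 * k + 1) * lindelofKernel a (1 / 2 + t * I) := fun k => by
    obtain ⟨_, -, hE⟩ := exists_integral_lindelofKernel_bound ha (2 * k + 1)
    refine (hE (fun t => ((1 / 2 : ℂ) + t * I) ^ (2 * k + 1)) 1 (by fun_prop) zero_le_one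
      fun t => ?_).1
    rw [norm_pow, one_mul]
    gcongr
    exact norm_half_add_mul_I_le t
  have hcont : Continuous fun t : ℝ => mathieuFun s r (1 / 2 + t * I) :=
    (differentiableOn_mathieuFun s r).continuousOn.comp_continuous (by fun_prop)
      fun t => by simp
  have hg : Integrable fun t : ℝ =>
      mathieuFun s r (1 / 2 + t * I) * lindelofKernel a (1 / 2 + t * I) := by
    obtain ⟨_, -, hE⟩ := exists_integral_lindelofKernel_bound ha 1
    refine (hE (fun t => mathieuFun s r (1 / 2 + t * I)) (2 / ((1 / 2) ^ 2) ^ s) hcont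
      (by positivity) fun t => ?_).1
    refine (norm_mathieuFun_le_of_le_re hs r (c := 1 / 2) (by norm_num) (by simp)).trans ?_
    rw [pow_one, div_mul_eq_mul_div]
    gcongr
    exact norm_half_add_mul_I_le t
  have hsum : Integrable fun t : ℝ => ∑ k ∈ Finset.range N, Ring.choose (-(s : ℂ)) k *
      (2 * ((r ^ (-2 * s - 2 * k) : ℝ) : ℂ)) *
        (((1 / 2 : ℂ) + t * I) ^ (2 * k + 1) * lindelofKernel a (1 / 2 + t * I)) :=
    integrable_finsetSum _ fun k _ => (hmono k).const_mul _
  have hb := (hD (fun t => mathieuFun s r (1 / 2 + t * I) - ∑ k ∈ Finset.range N,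
    Ring.choose (-(s : ℂ)) k * (2 * ((r ^ (-2 * s - 2 * k) : ℝ) : ℂ)) *
      (1 / 2 + t * I) ^ (2 * k + 1)) (C * r ^ (-2 * s - 2 * N)) (by fun_prop) (by positivity)
    (fun t => hC r hr t)).2
  rw [mul_right_comm] at hb
  refine le_trans (le_of_eq ?_) hb
  congr 1
  simp only [lindelofTransform, sub_mul, Finset.sum_mul, mul_assoc] at hsum ⊢
  rw [integral_sub hg hsum, integral_finsetSum]
  · simp only [integral_const_mul]
  · intro k _
    exact (((hmono k).const_mul _).const_mul _).const_mul _

/-! ### Polylogarithms and conclusion -/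

theorem neg_exp_sub_pi (x : ℝ) : -cexp (((x - Real.pi : ℝ) : ℂ) * I) = cexp (I * x) := by
  push_cast
  rw [sub_mul, Complex.exp_sub, Complex.exp_pi_mul_I, div_neg, div_one, neg_neg, mul_comm]

theorem polylog_neg_odd_eq {x : ℝ} (hx : x ∈ Set.Ioo 0 (2 * Real.pi)) (k : ℕ) :
    polylog (-2 * (k : ℂ) - 1) (cexp (I * x)) =
      -(1 / (2 * Real.pi)) * lindelofTransform (x - Real.pi) (fun u => u ^ (2 * k + 1)) := by
  have hn : ‖cexp (I * x)‖ = 1 := Complex.norm_exp_I_mul_ofReal x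
  rw [polylog, if_neg (by rw [hn]; exact lt_irrefl _), lindelofIntegral, ← neg_exp_sub_pi, neg_neg,
    lindelofTransform]
  have h1 : ∀ t : ℝ, cexp (((x - Real.pi : ℝ) : ℂ) * I) ^ ((1 / 2 : ℂ) + t * I) /
      ((1 / 2 : ℂ) + t * I) ^ (-2 * (k : ℂ) - 1) *
      ((Real.pi : ℂ) / Complex.sin (Real.pi * ((1 / 2 : ℂ) + t * I))) * I =
      I * (((1 / 2 : ℂ) + t * I) ^ (2 * k + 1) *
        lindelofKernel (x - Real.pi) (1 / 2 + t * I)) := fun t => by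
    -- Here `0 < x < 2π` matters: `x - π` is then the principal argument of `-z`.
    have hlog : Complex.log (cexp (((x - Real.pi : ℝ) : ℂ) * I)) = ((x - Real.pi : ℝ) : ℂ) * I := by
      apply Complex.log_exp
      · simp; linarith [hx.1]
      · simp; linarith [hx.2]
    rw [Complex.cpow_def_of_ne_zero (Complex.exp_ne_zero _), hlog,
      show -2 * (k : ℂ) - 1 = -((2 * k + 1 : ℕ) : ℂ) by push_cast; ring, Complex.cpow_neg,
      Complex.cpow_natCast, div_inv_eq_mul, lindelofKernel]
    ring
  simp_rw [h1]
  rw [integral_const_mul]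
  have hpi : (Real.pi : ℂ) ≠ 0 := by exact_mod_cast Real.pi_ne_zero
  field_simp

theorem pow_mul_mathieuFun_eq (μ x r : ℝ) (n : ℕ) :
    cexp (I * x) ^ (n + 1) * mathieuFun (μ + 1) r ((n : ℂ) + 1) =
      (mathieuCosTerm μ x r (n + 1) : ℂ) + (mathieuSinTerm μ x r (n + 1) : ℂ) * I := by
  have h1 : cexp (I * x) ^ (n + 1) =
      (Real.cos (((n + 1 : ℕ) : ℝ) * x) : ℂ) + (Real.sin (((n + 1 : ℕ) : ℝ) * x) : ℂ) * I := by
    rw [← Complex.exp_nat_mul, Complex.ofReal_cos, Complex.ofReal_sin, ← Complex.exp_mul_I]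
    push_cast
    ring_nf
  have h2 := mathieuFun_ofReal (s := μ + 1) (r := r) (y := ((n + 1 : ℕ) : ℝ))
  rw [h1, show (n : ℂ) + 1 = (((n + 1 : ℕ) : ℝ) : ℂ) by push_cast; rfl, h2, mathieuCosTerm,
    mathieuSinTerm]
  push_cast
  ring

theorem mathieu_asymptotics {μ x : ℝ} (hμ : 0 < μ) (hx : x ∈ Set.Ioo 0 (2 * Real.pi)) (N : ℕ) :
    (fun r : ℝ => (∑' n : ℕ, cexp (I * x) ^ (n + 1) * mathieuFun (μ + 1) r ((n : ℂ) + 1)) -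
      ∑ k ∈ Finset.range (N + 1), ((2 * (-1) ^ k * Real.Gamma ((k : ℝ) + μ + 1) /
        ((k.factorial : ℝ) * Real.Gamma (μ + 1)) * r ^ (-2 * (k : ℝ) - 2 * μ - 2) : ℝ) : ℂ) *
          polylog (-2 * (k : ℂ) - 1) (cexp (I * x)))
      =o[atTop] fun r : ℝ => r ^ (-2 * (N : ℝ) - 2 * μ - 2) := by
  have ha : |x - Real.pi| < Real.pi := by
    rw [abs_lt]; constructor <;> linarith [hx.1, hx.2]
  -- Keeping the terms `k ≤ N` leaves an error two powers of `r` below the last one, hence little-o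
  -- of it.
  obtain ⟨C, hC⟩ := exists_norm_lindelofTransform_mathieuFun_sub_le ha (s := μ + 1)
    (by linarith) (N + 1)
  refine Asymptotics.IsBigO.trans_isLittleO (g := fun r : ℝ => r ^ (-2 * (N : ℝ) - 2 * μ - 4)) ?_
    (isLittleO_rpow_atTop_of_lt (by linarith))
  refine Asymptotics.IsBigO.of_bound (1 / (2 * Real.pi) * C) ?_
  filter_upwards [eventually_ge_atTop 1] with r hr
  have hr0 : 0 < r := by linarith
  rw [tsum_mathieuFun_eq ha (by linarith) r (neg_exp_sub_pi x).symm]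
  have hsum : ∑ k ∈ Finset.range (N + 1), ((2 * (-1) ^ k * Real.Gamma ((k : ℝ) + μ + 1) /
        ((k.factorial : ℝ) * Real.Gamma (μ + 1)) * r ^ (-2 * (k : ℝ) - 2 * μ - 2) : ℝ) : ℂ) *
          polylog (-2 * (k : ℂ) - 1) (cexp (I * x)) =
      -(1 / (2 * Real.pi)) * ∑ k ∈ Finset.range (N + 1), Ring.choose (-((μ + 1 : ℝ) : ℂ)) k *
        (2 * ((r ^ (-2 * (μ + 1) - 2 * (k : ℝ)) : ℝ) : ℂ)) *
          lindelofTransform (x - Real.pi) (fun u => u ^ (2 * k + 1)) := by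
    rw [Finset.mul_sum]
    refine Finset.sum_congr rfl fun k _ => ?_
    rw [polylog_neg_odd_eq hx, choose_neg_eq_Gamma (by linarith),
      show -2 * (μ + 1) - 2 * (k : ℝ) = -2 * (k : ℝ) - 2 * μ - 2 by ring, ← add_assoc]
    push_cast
    ring
  rw [hsum, ← mul_sub, norm_mul, Real.norm_of_nonneg (by positivity), mul_assoc]
  refine mul_le_mul (le_of_eq ?_) ?_ (norm_nonneg _) (by positivity)
  · rw [norm_neg, norm_div, norm_mul, Complex.norm_real, Real.norm_of_nonneg Real.pi_pos.le]
    simp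
  · refine (hC r hr).trans_eq ?_
    push_cast
    ring_nf

theorem mainTheorem3 (μ x : ℝ) (hμ : 0 < μ) (hx : x ∈ Set.Ioo 0 (2 * Real.pi)) :
    (∀ r : ℝ, 0 < r →
      Summable (fun n : ℕ => mathieuCosTerm μ x r (n + 1)) ∧
      Summable (fun n : ℕ => mathieuSinTerm μ x r (n + 1))) ∧
    HasAsymptoticExpansion
      (fun r : ℝ => ∑' n : ℕ, mathieuCosTerm μ x r (n + 1))
      (fun (k : ℕ) (r : ℝ) => r ^ (-2 * (k : ℝ) - 2 * μ - 2))
      (fun k : ℕ =>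
        2 * (-1) ^ k * Real.Gamma ((k : ℝ) + μ + 1) / ((k.factorial : ℝ) * Real.Gamma (μ + 1)) *
          (polylog (-2 * (k : ℂ) - 1) (Complex.exp (Complex.I * (x : ℂ)))).re)
      Filter.atTop ∧
    HasAsymptoticExpansion
      (fun r : ℝ => ∑' n : ℕ, mathieuSinTerm μ x r (n + 1))
      (fun (k : ℕ) (r : ℝ) => r ^ (-2 * (k : ℝ) - 2 * μ - 2))
      (fun k : ℕ =>
        2 * (-1) ^ k * Real.Gamma ((k : ℝ) + μ + 1) / ((k.factorial : ℝ) * Real.Gamma (μ + 1)) *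
          (polylog (-2 * (k : ℂ) - 1) (Complex.exp (Complex.I * (x : ℂ)))).im)
      Filter.atTop := by
  have hz : ‖cexp (I * x)‖ = 1 := Complex.norm_exp_I_mul_ofReal x
  have hS := fun r : ℝ => summable_mathieuFun (s := μ + 1) (by linarith) r hz
  have hcos : ∀ r : ℝ, HasSum (fun n : ℕ => mathieuCosTerm μ x r (n + 1))
      (∑' n : ℕ, cexp (I * x) ^ (n + 1) * mathieuFun (μ + 1) r ((n : ℂ) + 1)).re := fun r => by
    simpa [pow_mul_mathieuFun_eq] using Complex.hasSum_re (hS r).hasSum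
  have hsin : ∀ r : ℝ, HasSum (fun n : ℕ => mathieuSinTerm μ x r (n + 1))
      (∑' n : ℕ, cexp (I * x) ^ (n + 1) * mathieuFun (μ + 1) r ((n : ℂ) + 1)).im := fun r => by
    simpa [pow_mul_mathieuFun_eq] using Complex.hasSum_im (hS r).hasSum
  have hscale : ∀ k : ℕ, (fun r : ℝ => r ^ (-2 * ((k + 1 : ℕ) : ℝ) - 2 * μ - 2)) =o[atTop]
      fun r : ℝ => r ^ (-2 * (k : ℝ) - 2 * μ - 2) := fun k =>
    isLittleO_rpow_atTop_of_lt (by push_cast; linarith)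
  -- For real series, `Summable` is absolute convergence.
  refine ⟨fun r _ => ⟨(hcos r).summable, (hsin r).summable⟩,
    ⟨hscale, fun N => ?_⟩, ⟨hscale, fun N => ?_⟩⟩
  · refine Asymptotics.IsBigO.trans_isLittleO ?_ (mathieu_asymptotics hμ hx N)
    refine Asymptotics.IsBigO.of_bound 1 (Eventually.of_forall fun r => ?_)
    rw [one_mul]
    refine le_trans (le_of_eq ?_) (Complex.abs_re_le_norm _)
    beta_reduce
    rw [Real.norm_eq_abs, (hcos r).tsum_eq, Complex.sub_re, Complex.re_sum]
    congr! 3 with k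
    rw [Complex.re_ofReal_mul]
    ring
  · refine Asymptotics.IsBigO.trans_isLittleO ?_ (mathieu_asymptotics hμ hx N)
    refine Asymptotics.IsBigO.of_bound 1 (Eventually.of_forall fun r => ?_)
    rw [one_mul]
    refine le_trans (le_of_eq ?_) (Complex.abs_im_le_norm _)
    beta_reduce
    rw [Real.norm_eq_abs, (hsin r).tsum_eq, Complex.sub_im, Complex.im_sum]
    congr! 3 with k
    rw [Complex.im_ofReal_mul]
    ring
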